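/- Let $G=\mathbb{Z}_2=\{e,g\}$ act by algebra automorphisms on $M_2(\mathbb{C})$, and on its Lie subalgebra $sl_2(\mathbb{C})$ of traceless matrices, with $g$ acting as $g(a)=BaB^{-1}$, where $B=e_{11}-e_{22}$. Let $\mathbb{C}\langle X;G\rangle$ be the free unital associative $\mathbb{C}$-algebra freely generated by the symbols $x^h$ with $x\in X$, $h\in G$, where $X$ is a countably infinite set of variables; write $x=x^e$, and let $G$ act on $\mathbb{C}\langle X;G\rangle$ by the algebra automorphisms with $h'(x^{h})=x^{h'h}$. Let $L\langle X;G\rangle$ be the free Lie $G$-algebra, that is, the Lie subalgebra (for $[a,b]=ab-ba$) of $\mathbb{C}\langle X;G\rangle$ generated by all the $x^h$. A weak $G$-identity of the pair $(M_2(\mathbb{C}),sl_2(\mathbb{C}))$ is an element of $\mathbb{C}\langle X;G\rangle$ that vanishes whenever each variable $x\in X$ is replaced by an element $a_x\in sl_2(\mathbb{C})$ and each $x^h$ by $h(a_x)$. A $G$-ideal is a two-sided ideal of $\mathbb{C}\langle X;G\rangle$ that is mapped into itself by every unital algebra endomorphism $\varphi$ of $\mathbb{C}\langle X;G\rangle$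 that commutes with the action of $G$ and satisfies $\varphi(L\langle X;G\rangle)\subseteq L\langle X;G\rangle$. Put $\pi_0(x)=x+g(x)$ and $\pi_1(x)=x-g(x)$, and let $x_1,x_2,x_3\in X$ be distinct variables. Then the following polynomials form a basis of the weak $G$-identities of the pair $(M_2(\mathbb{C}),sl_2(\mathbb{C}))$: 1. $[\pi_0(x_1),\pi_0(x_2)]$, 2. $\pi_1(x_1)\pi_1(x_2)\pi_1(x_3)-\pi_1(x_3)\pi_1(x_2)\pi_1(x_1)$, 3. $\pi_0(x_1)\pi_1(x_2)+\pi_1(x_2)\pi_0(x_1)$. That is, the set of all weak $G$-identities of the pair is a $G$-ideal, and it is the least $G$-ideal containing these three polynomials. -/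

import Mathlib

namespace WeakGId

noncomputable section

attribute [local instance 100] LieRing.ofAssociativeRing

/-- An associative-Lie `G`-pair `(A, L)`: a group `G` acting on the unital associative `F`-algebra
`A` by `F`-algebra automorphisms, together with a Lie subalgebra `L` of `A` (with respect to the
commutator bracket `[a, b] = a * b - b * a`) which is invariant under the action. -/
structure GPair (F G A : Type*) [Field F] [Group G] [Ring A] [Algebra F A] where
  act : G →* (A ≃ₐ[F] A)
  lie : LieSubalgebra F A
  act_mem : ∀ (g : G) (a : A), a ∈ lie → act g a ∈ lie

/-- `φ` is a homomorphism of `G`-pairs: a homomorphism of unital `F`-algebras which maps the Lie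
part to the Lie part and commutes with the action of `G`. -/
def IsGPairHom {F G A B : Type*} [Field F] [Group G] [Ring A] [Algebra F A] [Ring B] [Algebra F B]
    (P : GPair F G A) (Q : GPair F G B) (φ : A →ₐ[F] B) : Prop :=
  (∀ a ∈ P.lie, φ a ∈ Q.lie) ∧ ∀ (g : G) (a : A), φ (P.act g a) = Q.act g (φ a)

/-- The free associative algebra `F⟨X; G⟩`, freely generated by `X × G`, for the countable set of
variables `X = {x_0, x_1, x_2, …}`. Its elements are the `G`-polynomials. The generator `(i, g)` is
`x_i^g`. -/
abbrev GPoly (F G : Type*) [Field F] [Group G] : Type _ := FreeAlgebra F (ℕ × G)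

/-- The variable `x_i = x_i^e`. -/
def var (F G : Type*) [Field F] [Group G] (i : ℕ) : GPoly F G := FreeAlgebra.ι F (i, (1 : G))

/-- The endomorphism of `F⟨X; G⟩` given by `x_i^h ↦ x_i^(g h)`. -/
def shift (F : Type*) {G : Type*} [Field F] [Group G] (g : G) : GPoly F G →ₐ[F] GPoly F G :=
  FreeAlgebra.lift F fun p : ℕ × G => FreeAlgebra.ι F (p.1, g * p.2)

theorem shift_ι (F : Type*) {G : Type*} [Field F] [Group G] (g : G) (p : ℕ × G) :
    shift F g (FreeAlgebra.ι F p) = FreeAlgebra.ι F (p.1, g * p.2) := by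
  simp [shift]

theorem shift_comp (F : Type*) {G : Type*} [Field F] [Group G] (g h : G) :
    (shift F g).comp (shift F h) = shift F (g * h) := by
  apply FreeAlgebra.hom_ext
  funext p
  simp [shift_ι, mul_assoc]

theorem shift_one (F : Type*) {G : Type*} [Field F] [Group G] :
    shift F (1 : G) = AlgHom.id F (GPoly F G) := by
  apply FreeAlgebra.hom_ext
  funext p
  simp [shift_ι]

/-- The action of `G` on `F⟨X; G⟩` by automorphisms. -/
def freeAct (F G : Type*) [Field F] [Group G] : G →* (GPoly F G ≃ₐ[F] GPoly F G) where
  toFun g := AlgEquiv.ofAlgHom (shift F g) (shift F g⁻¹)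
    (by rw [shift_comp, mul_inv_cancel, shift_one])
    (by rw [shift_comp, inv_mul_cancel, shift_one])
  map_one' := by
    ext a
    simp [shift_one]
  map_mul' g h := by
    ext a
    simp [← shift_comp]

/-- The free Lie `G`-algebra `L⟨X; G⟩`, realized as the Lie subalgebra of `F⟨X; G⟩` generated by
`X × G`. -/
def freeLie (F G : Type*) [Field F] [Group G] : LieSubalgebra F (GPoly F G) :=
  LieSubalgebra.lieSpan F (GPoly F G) (Set.range (FreeAlgebra.ι F))

theorem freeAct_mem (F G : Type*) [Field F] [Group G] (g : G) (a : GPoly F G)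
    (ha : a ∈ freeLie F G) : freeAct F G g a ∈ freeLie F G := by
  have h : freeLie F G ≤
      (freeLie F G).comap ((freeAct F G g : GPoly F G →ₐ[F] GPoly F G) :
        GPoly F G →ₗ⁅F⁆ GPoly F G) := by
    refine LieSubalgebra.lieSpan_le.2 ?_
    rintro _ ⟨p, rfl⟩
    have h1 : freeAct F G g (FreeAlgebra.ι F p) = FreeAlgebra.ι F (p.1, g * p.2) := shift_ι F g p
    have h2 : freeAct F G g (FreeAlgebra.ι F p) ∈ freeLie F G := by
      rw [h1]
      exact LieSubalgebra.subset_lieSpan ⟨_, rfl⟩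
    exact h2
  exact h ha

/-- The free associative-Lie `G`-pair `(F⟨X; G⟩, L⟨X; G⟩)`. -/
def freePair (F G : Type*) [Field F] [Group G] : GPair F G (GPoly F G) where
  act := freeAct F G
  lie := freeLie F G
  act_mem := freeAct_mem F G

/-- The value `f(a_i^g)` of the `G`-polynomial `f` under the substitution `x_i ↦ a i`, that is
`x_i^g ↦ g (a i)`. -/
def eval {F G A : Type*} [Field F] [Group G] [Ring A] [Algebra F A] (P : GPair F G A)
    (a : ℕ → A) : GPoly F G →ₐ[F] A :=
  FreeAlgebra.lift F fun p : ℕ × G => P.act p.2 (a p.1)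

/-- The ideal `Id^G(A, L)` of weak `G`-identities of the pair `(A, L)`: the `G`-polynomials that
vanish under every substitution of the variables by elements of `L`. -/
def weakIdentities {F G A : Type*} [Field F] [Group G] [Ring A] [Algebra F A] (P : GPair F G A) :
    TwoSidedIdeal (GPoly F G) :=
  TwoSidedIdeal.mk' {f | ∀ a : ℕ → A, (∀ i, a i ∈ P.lie) → eval P a f = 0}
    (fun a _ => map_zero _)
    (fun {x y} hx hy a ha => by rw [map_add, hx a ha, hy a ha, add_zero])
    (fun {x} hx a ha => by rw [map_neg, hx a ha, neg_zero])
    (fun {x y} hy a ha => by rw [map_mul, hy a ha, mul_zero])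
    (fun {x y} hx a ha => by rw [map_mul, hx a ha, zero_mul])

theorem mem_weakIdentities {F G A : Type*} [Field F] [Group G] [Ring A] [Algebra F A]
    (P : GPair F G A) (f : GPoly F G) :
    f ∈ weakIdentities P ↔ ∀ a : ℕ → A, (∀ i, a i ∈ P.lie) → eval P a f = 0 :=
  TwoSidedIdeal.mem_mk' _ _ _ _ _ _ _

/-- A `G`-ideal of `F⟨X; G⟩`: a two-sided ideal invariant under all endomorphisms of the `G`-pair
`(F⟨X; G⟩, L⟨X; G⟩)`. -/
def IsGIdeal {F G : Type*} [Field F] [Group G] (I : TwoSidedIdeal (GPoly F G)) : Prop :=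
  ∀ φ : GPoly F G →ₐ[F] GPoly F G, IsGPairHom (freePair F G) (freePair F G) φ →
    ∀ f ∈ I, φ f ∈ I

/-- `S` is a basis of the weak `G`-identities of the pair: `Id^G(A, L)` is the least `G`-ideal
that contains `S`. -/
def IsBasis {F G A : Type*} [Field F] [Group G] [Ring A] [Algebra F A] (P : GPair F G A)
    (S : Set (GPoly F G)) : Prop :=
  IsLeast {I : TwoSidedIdeal (GPoly F G) | IsGIdeal I ∧ ∀ f ∈ S, f ∈ I} (weakIdentities P)

/-- The group `ℤ₂`, written multiplicatively. -/
abbrev Z2 : Type := Multiplicative (ZMod 2)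

/-- The generator of `ℤ₂`. -/
def gen : Z2 := Multiplicative.ofAdd 1

/-- The matrix `e₁₁ - e₂₂`. -/
def B : Matrix (Fin 2) (Fin 2) ℂ := !![1, 0; 0, -1]

theorem B_mul_B : B * B = 1 := by
  simp [B, Matrix.one_fin_two]

theorem B_mul_inv : B * B⁻¹ = 1 := by
  rw [Matrix.inv_eq_right_inv B_mul_B, B_mul_B]

theorem B_inv_mul : B⁻¹ * B = 1 := by
  rw [Matrix.inv_eq_right_inv B_mul_B, B_mul_B]

/-- The automorphism `x ↦ B x B⁻¹` of `M₂(ℂ)`, where `B = e₁₁ - e₂₂`. -/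
def conjB : Matrix (Fin 2) (Fin 2) ℂ ≃ₐ[ℂ] Matrix (Fin 2) (Fin 2) ℂ where
  toFun x := B * x * B⁻¹
  invFun x := B⁻¹ * x * B
  left_inv x := by
    calc B⁻¹ * (B * x * B⁻¹) * B = (B⁻¹ * B) * x * (B⁻¹ * B) := by simp only [mul_assoc]
      _ = x := by rw [B_inv_mul, one_mul, mul_one]
  right_inv x := by
    calc B * (B⁻¹ * x * B) * B⁻¹ = (B * B⁻¹) * x * (B * B⁻¹) := by simp only [mul_assoc]
      _ = x := by rw [B_mul_inv, one_mul, mul_one]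
  map_mul' x y := by
    calc B * (x * y) * B⁻¹ = B * x * (1 * (y * B⁻¹)) := by simp only [mul_assoc, one_mul]
      _ = B * x * B⁻¹ * (B * y * B⁻¹) := by rw [← B_inv_mul]; simp only [mul_assoc]
  map_add' x y := by rw [mul_add, add_mul]
  commutes' r := by
    rw [← Algebra.commutes r B, mul_assoc, B_mul_inv, mul_one]

theorem conjB_sq : conjB ^ 2 = 1 := by
  ext1 x
  change B * (B * x * B⁻¹) * B⁻¹ = x
  rw [Matrix.inv_eq_right_inv B_mul_B]
  calc B * (B * x * B) * B = (B * B) * x * (B * B) := by simp only [mul_assoc]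
    _ = x := by rw [B_mul_B, one_mul, mul_one]

/-- The action of `ℤ₂` on `M₂(ℂ)` in which the generator acts by conjugation with `e₁₁ - e₂₂`. -/
def actM2 : Z2 →* (Matrix (Fin 2) (Fin 2) ℂ ≃ₐ[ℂ] Matrix (Fin 2) (Fin 2) ℂ) where
  toFun k := conjB ^ (Multiplicative.toAdd k).val
  map_one' := by simp
  map_mul' k l := by
    rw [← pow_add, toAdd_mul, ZMod.val_add]
    exact (pow_eq_pow_mod _ conjB_sq).symm

theorem actM2_gen : actM2 gen = conjB := pow_one conjB

theorem actM2_mem (g : Z2) (a : Matrix (Fin 2) (Fin 2) ℂ)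
    (ha : a ∈ LieAlgebra.SpecialLinear.sl (Fin 2) ℂ) :
    actM2 g a ∈ LieAlgebra.SpecialLinear.sl (Fin 2) ℂ := by
  have key : ∀ (n : ℕ), (conjB ^ n) a ∈ LieAlgebra.SpecialLinear.sl (Fin 2) ℂ := by
    intro n
    induction n with
    | zero => simpa using ha
    | succ n ih =>
      rw [pow_succ']
      change ((conjB ^ n) a).trace = 0 at ih
      change (B * (conjB ^ n) a * B⁻¹).trace = 0
      rw [Matrix.trace_mul_comm, ← mul_assoc, B_inv_mul, one_mul, ih]
  exact key _

/-- The `ℤ₂`-pair `(M₂(ℂ), sl₂(ℂ))`. -/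
def pairM2 : GPair ℂ Z2 (Matrix (Fin 2) (Fin 2) ℂ) where
  act := actM2
  lie := LieAlgebra.SpecialLinear.sl (Fin 2) ℂ
  act_mem := actM2_mem

/-- `π₀(f) = f + g(f)` on `ℤ₂`-polynomials, where `g` is the generator of `ℤ₂`. -/
def pi0 (f : GPoly ℂ Z2) : GPoly ℂ Z2 := f + (freePair ℂ Z2).act gen f

/-- `π₁(f) = f - g(f)` on `ℤ₂`-polynomials, where `g` is the generator of `ℤ₂`. -/
def pi1 (f : GPoly ℂ Z2) : GPoly ℂ Z2 := f - (freePair ℂ Z2).act gen f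

/-- The variable `x_i` of `ℂ⟨X; ℤ₂⟩`. -/
abbrev x (i : ℕ) : GPoly ℂ Z2 := var ℂ Z2 i

end

end WeakGId

/-!
Substituting into a weak identity a homomorphism of pairs gives a weak identity, so the weak
identities form a `G`-ideal (`isGIdeal_weakIdentities`), and the three polynomials vanish on
`sl₂(ℂ)` by direct computation with `eval_pi0` and `eval_pi1`.

For minimality, let `I` be a `G`-ideal containing the three polynomials, and let `y_i`, `z_i` be the
classes modulo `I` of `π₀(x_i) / 2` and `π₁(x_i) / 2`. Renaming variables is a homomorphism of pairs,
so for all indices the `y_i` commute, `z_j y_i = -y_i z_j`, and `z_i z_j z_k = z_k z_j z_i`. Hence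
every word in the `y_i`, `z_i` is, up to sign, of the form
`y_{i₁} ⋯ y_{iₙ} z_{j₁} z_{k₁} z_{j₂} z_{k₂} ⋯`, where the order within each of the three families
of indices is irrelevant. On the generic matrices `y_i = diag(h_i, -h_i)`,
`z_i = b_i e₁₂ + c_i e₂₁`, the first row of such a word has a single nonzero entry, the commutative
monomial `h_{i₁} ⋯ h_{iₙ} b_{j₁} b_{j₂} ⋯ c_{k₁} c_{k₂} ⋯`, which determines the word.

This is made into a reconstruction formula: the linear maps `toStd` send commutative monomials back
to standard words, and `map_eq_toStd` shows that they recover the class of `f` from the first row of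
its generic value. The generic value of a weak identity is zero (`genericEval_eq_zero`), so its
class modulo `I` is zero.
-/

namespace WeakGId

noncomputable section

attribute [local instance 100] LieRing.ofAssociativeRing

/-! ### Homomorphisms of pairs and substitutions -/

section GeneralPairs

variable {F G A : Type*} [Field F] [Group G] [Ring A] [Algebra F A]

/-- A homomorphism of unital algebras commutes with commutator brackets, so the preimage of a Lie
subalgebra under it contains `L⟨X; G⟩` as soon as it contains the free generators. -/
theorem map_mem_of_mem_freeLie (L : LieSubalgebra F A) (φ : GPoly F G →ₐ[F] A)
    (h : ∀ p, φ (FreeAlgebra.ι F p) ∈ L) {f : GPoly F G} (hf : f ∈ freeLie F G) : φ f ∈ L := by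
  have : freeLie F G ≤ L.comap (φ : GPoly F G →ₗ⁅F⁆ A) := by
    refine LieSubalgebra.lieSpan_le.2 ?_
    rintro _ ⟨p, rfl⟩
    exact h p
  exact this hf

theorem var_mem_freeLie (i : ℕ) : var F G i ∈ freeLie F G :=
  LieSubalgebra.subset_lieSpan ⟨_, rfl⟩

theorem freePair_act_ι (g : G) (p : ℕ × G) :
    (freePair F G).act g (FreeAlgebra.ι F p) = FreeAlgebra.ι F (p.1, g * p.2) :=
  shift_ι F g p

theorem eval_ι (P : GPair F G A) (a : ℕ → A) (p : ℕ × G) :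
    eval P a (FreeAlgebra.ι F p) = P.act p.2 (a p.1) := by
  simp [eval]

theorem eval_act (P : GPair F G A) (a : ℕ → A) (g : G) (f : GPoly F G) :
    eval P a ((freePair F G).act g f) = P.act g (eval P a f) := by
  have h : (eval P a).comp ((freePair F G).act g : GPoly F G →ₐ[F] GPoly F G)
      = (P.act g : A →ₐ[F] A).comp (eval P a) := by
    apply FreeAlgebra.hom_ext
    funext p
    simp [freePair_act_ι, eval_ι]
  exact DFunLike.congr_fun h f

theorem eval_mem_lie (P : GPair F G A) {a : ℕ → A} (ha : ∀ i, a i ∈ P.lie) {f : GPoly F G}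
    (hf : f ∈ freeLie F G) : eval P a f ∈ P.lie := by
  refine map_mem_of_mem_freeLie P.lie (eval P a) (fun p => ?_) hf
  rw [eval_ι]
  exact P.act_mem _ _ (ha _)

/-- Substituting `a` into `φ f` amounts to substituting the values of the `φ (x_i)` into `f`. -/
theorem eval_comp_hom (P : GPair F G A) (a : ℕ → A) {φ : GPoly F G →ₐ[F] GPoly F G}
    (hφ : IsGPairHom (freePair F G) (freePair F G) φ) (f : GPoly F G) :
    eval P a (φ f) = eval P (fun i => eval P a (φ (var F G i))) f := by
  have h : (eval P a).comp φ = eval P (fun i => eval P a (φ (var F G i))) := by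
    apply FreeAlgebra.hom_ext
    funext p
    have hp : FreeAlgebra.ι F p = (freePair F G).act p.2 (var F G p.1) := by
      simp [var, freePair_act_ι]
    simp only [Function.comp_apply, AlgHom.comp_apply, eval_ι]
    rw [hp, hφ.2, eval_act]
  exact DFunLike.congr_fun h f

theorem isGIdeal_weakIdentities (P : GPair F G A) : IsGIdeal (weakIdentities P) := by
  intro φ hφ f hf
  rw [mem_weakIdentities] at hf ⊢
  intro a ha
  rw [eval_comp_hom P a hφ]
  exact hf _ fun i => eval_mem_lie P ha (hφ.1 _ (var_mem_freeLie i))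

/-- The endomorphism `x_i^g ↦ x_{σ i}^g` of `F⟨X; G⟩`. -/
def rename (F G : Type*) [Field F] [Group G] (σ : ℕ → ℕ) : GPoly F G →ₐ[F] GPoly F G :=
  FreeAlgebra.lift F fun p : ℕ × G => FreeAlgebra.ι F (σ p.1, p.2)

theorem rename_ι (σ : ℕ → ℕ) (p : ℕ × G) :
    rename F G σ (FreeAlgebra.ι F p) = FreeAlgebra.ι F (σ p.1, p.2) := by
  simp [rename]

theorem isGPairHom_rename (σ : ℕ → ℕ) :
    IsGPairHom (freePair F G) (freePair F G) (rename F G σ) := by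
  refine ⟨fun f hf => ?_, fun g f => ?_⟩
  · refine map_mem_of_mem_freeLie (freePair F G).lie (rename F G σ) (fun p => ?_) hf
    rw [rename_ι]
    exact LieSubalgebra.subset_lieSpan ⟨_, rfl⟩
  · have h : (rename F G σ).comp ((freePair F G).act g : GPoly F G →ₐ[F] GPoly F G)
        = ((freePair F G).act g : GPoly F G →ₐ[F] GPoly F G).comp (rename F G σ) := by
      apply FreeAlgebra.hom_ext
      funext p
      simp [freePair_act_ι, rename_ι]
    exact DFunLike.congr_fun h f

end GeneralPairs

/-! ### Alternating products -/

section Alternating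

variable {Q : Type*} [Ring Q]

/-- The alternating product `z_{j₁} z_{k₁} z_{j₂} z_{k₂} ⋯` of the lists `j` and `k`. It stops as
soon as the list whose turn it is has run out, so it involves all entries exactly when `j` has as
many entries as `k` or one more. -/
def altProd (z : ℕ → Q) : List ℕ → List ℕ → Q
  | [], _ => 1
  | j :: J, K => z j * altProd z K J
termination_by J K => J.length + K.length

variable {y z : ℕ → Q}

/-- Permuting either list is possible because the relation `z_i z_j z_k = z_k z_j z_i` swaps two
entries at distance two. -/
theorem altProd_perm_aux (hz : ∀ i j k, z i * z j * z k = z k * z j * z i) {L L' : List ℕ}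
    (h : L.Perm L') : ∀ K : List ℕ,
      (L.length = K.length ∨ L.length = K.length + 1 → altProd z L K = altProd z L' K) ∧
      (K.length = L.length ∨ K.length = L.length + 1 → altProd z K L = altProd z K L') := by
  induction h with
  | nil => simp
  | @cons a L L' h ih =>
    intro K
    refine ⟨fun hK => ?_, fun hK => ?_⟩
    · rw [altProd, altProd, (ih K).2 (by simp at hK; omega)]
    · rcases K with _ | ⟨k, K⟩
      · simp at hK
      · rw [altProd, altProd, altProd, altProd, (ih K).2 (by simp at hK; omega)]
  | swap a b L =>
    intro K
    refine ⟨fun hK => ?_, fun hK => ?_⟩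
    · rcases K with _ | ⟨k, K⟩
      · simp at hK
      · simp only [altProd, ← mul_assoc, hz b k a]
    · rcases K with _ | ⟨k, _ | ⟨l, K⟩⟩
      · simp at hK
      · simp at hK
      · simp only [altProd, ← mul_assoc]
        rw [mul_assoc (z k), mul_assoc (z k), hz b l a, ← mul_assoc, ← mul_assoc]
  | trans h h' ih ih' =>
    intro K
    refine ⟨fun hK => ?_, fun hK => ?_⟩
    · rw [(ih K).1 hK, (ih' K).1 (by rwa [← h.length_eq])]
    · rw [(ih K).2 hK, (ih' K).2 (by rwa [← h.length_eq])]

theorem altProd_perm (hz : ∀ i j k, z i * z j * z k = z k * z j * z i) {J J' K K' : List ℕ}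
    (hJ : J.Perm J') (hK : K.Perm K') (h : J.length = K.length ∨ J.length = K.length + 1) :
    altProd z J K = altProd z J' K' := by
  rw [(altProd_perm_aux hz hJ K).1 h, (altProd_perm_aux hz hK J').2 (by rwa [← hJ.length_eq])]

/-- The next factor of an alternating product comes from the first list if the lengths are equal,
and from the second one otherwise. -/
theorem altProd_mul_z (z : ℕ → Q) (i : ℕ) (J K : List ℕ) :
    (J.length = K.length → altProd z J K * z i = altProd z (J ++ [i]) K) ∧
    (J.length = K.length + 1 → altProd z J K * z i = altProd z J (K ++ [i])) := by
  induction J, K using altProd.induct with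
  | case1 K =>
    refine ⟨fun h => ?_, fun h => by simp at h⟩
    rw [List.length_eq_zero_iff.1 h.symm]
    simp [altProd]
  | case2 K j J ih =>
    refine ⟨fun h => ?_, fun h => ?_⟩
    · rw [List.cons_append, altProd, altProd, mul_assoc, ih.2 (by simpa using h.symm)]
    · rw [altProd, altProd, mul_assoc, ih.1 (by simpa using h.symm)]

theorem altProd_mul_y (hyz : ∀ i j, z j * y i = -(y i * z j)) (i : ℕ) (J K : List ℕ) :
    (J.length = K.length → altProd z J K * y i = y i * altProd z J K) ∧
    (J.length = K.length + 1 → altProd z J K * y i = -(y i * altProd z J K)) := by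
  induction J, K using altProd.induct with
  | case1 K => simp [altProd]
  | case2 K j J ih =>
    refine ⟨fun h => ?_, fun h => ?_⟩
    · rw [altProd, mul_assoc, ih.2 (by simpa using h.symm), mul_neg, ← mul_assoc, hyz, neg_mul,
        neg_neg, mul_assoc]
    · rw [altProd, mul_assoc, ih.1 (by simpa using h.symm), ← mul_assoc, hyz, neg_mul, mul_assoc]

/-! ### Standard monomials -/

/-- The multiset of the indices `i` for which the variable `(i, t)` occurs in the monomial with
exponent `s`, counted with multiplicity. -/
def indices (t : Fin 3) (s : ℕ × Fin 3 →₀ ℕ) : Multiset ℕ :=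
  (Finsupp.toMultiset s).filterMap fun p => if p.2 = t then some p.1 else none

theorem indices_zero (t : Fin 3) : indices t 0 = 0 := by
  simp [indices]

theorem indices_add_single_self (t : Fin 3) (s : ℕ × Fin 3 →₀ ℕ) (i : ℕ) :
    indices t (s + Finsupp.single (i, t) 1) = indices t s + {i} := by
  simp [indices, Finsupp.toMultiset_single, ← Multiset.cons_zero]

theorem indices_add_single_of_ne {t u : Fin 3} (h : u ≠ t) (s : ℕ × Fin 3 →₀ ℕ) (i : ℕ) :
    indices t (s + Finsupp.single (i, u) 1) = indices t s := by
  simp [indices, Finsupp.toMultiset_single, ← Multiset.cons_zero, h]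

/-- The standard monomial `y_{i₁} ⋯ y_{iₙ} z_{j₁} z_{k₁} z_{j₂} z_{k₂} ⋯` attached to the
commutative monomial `h_{i₁} ⋯ h_{iₙ} b_{j₁} b_{j₂} ⋯ c_{k₁} c_{k₂} ⋯`, where `h_i`, `b_i`, `c_i` are
the variables `(i, 0)`, `(i, 1)`, `(i, 2)`. -/
def stdMonomial (y z : ℕ → Q) (s : ℕ × Fin 3 →₀ ℕ) : Q :=
  ((indices 0 s).toList.map y).prod * altProd z (indices 1 s).toList (indices 2 s).toList

theorem stdMonomial_zero : stdMonomial y z 0 = 1 := by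
  simp [stdMonomial, indices_zero, altProd]

theorem perm_toList_add_singleton (s : Multiset ℕ) (i : ℕ) :
    (s.toList ++ [i]).Perm (s + {i}).toList := by
  rw [← Multiset.coe_eq_coe, ← Multiset.coe_add]
  simp

theorem prod_map_toList_mul (hy : ∀ i j, y i * y j = y j * y i) (s : Multiset ℕ) (i : ℕ) :
    (s.toList.map y).prod * y i = ((s + {i}).toList.map y).prod := by
  have h := ((perm_toList_add_singleton s i).map y).prod_eq'
    (List.pairwise_map.2 (List.pairwise_of_forall fun i j => hy i j))
  simpa using h

theorem stdMonomial_mul_y (hy : ∀ i j, y i * y j = y j * y i)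
    (hyz : ∀ i j, z j * y i = -(y i * z j)) (i : ℕ) (s : ℕ × Fin 3 →₀ ℕ) :
    ((indices 1 s).card = (indices 2 s).card →
      stdMonomial y z s * y i = stdMonomial y z (s + Finsupp.single (i, 0) 1)) ∧
    ((indices 1 s).card = (indices 2 s).card + 1 →
      stdMonomial y z s * y i = -stdMonomial y z (s + Finsupp.single (i, 0) 1)) := by
  have h := altProd_mul_y hyz i (indices 1 s).toList (indices 2 s).toList
  rw [Multiset.length_toList, Multiset.length_toList] at h
  simp only [stdMonomial, indices_add_single_self,
    indices_add_single_of_ne (show (0 : Fin 3) ≠ 1 by decide),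
    indices_add_single_of_ne (show (0 : Fin 3) ≠ 2 by decide), ← prod_map_toList_mul hy]
  exact ⟨fun hs => by rw [mul_assoc, h.1 hs, mul_assoc],
    fun hs => by rw [mul_assoc, h.2 hs, mul_neg, mul_assoc]⟩

theorem stdMonomial_mul_z (hz : ∀ i j k, z i * z j * z k = z k * z j * z i) (i : ℕ)
    (s : ℕ × Fin 3 →₀ ℕ) :
    ((indices 1 s).card = (indices 2 s).card →
      stdMonomial y z s * z i = stdMonomial y z (s + Finsupp.single (i, 1) 1)) ∧
    ((indices 1 s).card = (indices 2 s).card + 1 →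
      stdMonomial y z s * z i = stdMonomial y z (s + Finsupp.single (i, 2) 1)) := by
  have h := altProd_mul_z z i (indices 1 s).toList (indices 2 s).toList
  rw [Multiset.length_toList, Multiset.length_toList] at h
  refine ⟨fun hs => ?_, fun hs => ?_⟩
  · rw [stdMonomial, stdMonomial, mul_assoc, h.1 hs, indices_add_single_self,
      indices_add_single_of_ne (by decide), indices_add_single_of_ne (by decide),
      altProd_perm hz (perm_toList_add_singleton _ i) (List.Perm.refl _)]
    simp [hs]
  · rw [stdMonomial, stdMonomial, mul_assoc, h.2 hs, indices_add_single_self,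
      indices_add_single_of_ne (by decide), indices_add_single_of_ne (by decide),
      altProd_perm hz (List.Perm.refl _) (perm_toList_add_singleton _ i)]
    simp [hs]

variable [Algebra ℂ Q]

/-- The linear map which sends the monomials with `m` more variables of type `b` than of type `c`
to the corresponding standard monomials, and all other monomials to zero. -/
def toStd (y z : ℕ → Q) (m : ℕ) : MvPolynomial (ℕ × Fin 3) ℂ →ₗ[ℂ] Q :=
  (MvPolynomial.basisMonomials (ℕ × Fin 3) ℂ).constr ℂ fun s =>
    if (indices 1 s).card = (indices 2 s).card + m then stdMonomial y z s else 0

theorem toStd_monomial (m : ℕ) (s : ℕ × Fin 3 →₀ ℕ) :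
    toStd y z m (MvPolynomial.monomial s 1) =
      if (indices 1 s).card = (indices 2 s).card + m then stdMonomial y z s else 0 := by
  have h := (MvPolynomial.basisMonomials (ℕ × Fin 3) ℂ).constr_basis ℂ (fun s =>
    if (indices 1 s).card = (indices 2 s).card + m then stdMonomial y z s else 0) s
  rwa [MvPolynomial.coe_basisMonomials] at h

/-- Multiplication of polynomials by a variable can be compared with right multiplication by an
element of `Q` on monomials. -/
theorem toStd_mul_X {m n : ℕ} {v : ℕ × Fin 3} {q : Q}
    (h : ∀ s, toStd y z m (MvPolynomial.monomial (s + Finsupp.single v 1) 1)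
      = toStd y z n (MvPolynomial.monomial s 1) * q) (p : MvPolynomial (ℕ × Fin 3) ℂ) :
    toStd y z m (p * MvPolynomial.X v) = toStd y z n p * q := by
  have : (toStd y z m).comp (LinearMap.mulRight ℂ (MvPolynomial.X v))
      = (LinearMap.mulRight ℂ q).comp (toStd y z n) := by
    refine (MvPolynomial.basisMonomials (ℕ × Fin 3) ℂ).ext fun s => ?_
    simpa [MvPolynomial.X, MvPolynomial.monomial_mul] using h s
  exact DFunLike.congr_fun this p

/-- A diagonal generic matrix multiplies the first entry of a row by `h_i`. -/
theorem toStd_zero_mul_h (hy : ∀ i j, y i * y j = y j * y i)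
    (hyz : ∀ i j, z j * y i = -(y i * z j)) (i : ℕ) (p : MvPolynomial (ℕ × Fin 3) ℂ) :
    toStd y z 0 (p * MvPolynomial.X (i, 0)) = toStd y z 0 p * y i := by
  refine toStd_mul_X (fun s => ?_) p
  rw [toStd_monomial, toStd_monomial, indices_add_single_of_ne (by decide),
    indices_add_single_of_ne (by decide)]
  split_ifs with hs
  · rw [(stdMonomial_mul_y hy hyz i s).1 hs]
  · rw [zero_mul]

/-- The sign is that of the entry `-h_i` of a diagonal generic matrix; it comes from moving `y_i`
past an odd number of the `z_j`. -/
theorem toStd_one_mul_h (hy : ∀ i j, y i * y j = y j * y i)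
    (hyz : ∀ i j, z j * y i = -(y i * z j)) (i : ℕ) (p : MvPolynomial (ℕ × Fin 3) ℂ) :
    toStd y z 1 (p * MvPolynomial.X (i, 0)) = toStd y z 1 p * -y i := by
  refine toStd_mul_X (fun s => ?_) p
  rw [toStd_monomial, toStd_monomial, indices_add_single_of_ne (by decide),
    indices_add_single_of_ne (by decide)]
  split_ifs with hs
  · rw [mul_neg, (stdMonomial_mul_y hy hyz i s).2 hs, neg_neg]
  · rw [zero_mul]

theorem toStd_mul_b (hz : ∀ i j k, z i * z j * z k = z k * z j * z i) (i : ℕ)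
    (p : MvPolynomial (ℕ × Fin 3) ℂ) :
    toStd y z 1 (p * MvPolynomial.X (i, 1)) = toStd y z 0 p * z i := by
  refine toStd_mul_X (fun s => ?_) p
  rw [toStd_monomial, toStd_monomial, indices_add_single_self,
    indices_add_single_of_ne (by decide), Multiset.card_add, Multiset.card_singleton]
  by_cases hs : (indices 1 s).card = (indices 2 s).card
  · rw [if_pos (by omega), if_pos (by omega), (stdMonomial_mul_z hz i s).1 hs]
  · rw [if_neg (by omega), if_neg (by omega), zero_mul]

theorem toStd_mul_c (hz : ∀ i j k, z i * z j * z k = z k * z j * z i) (i : ℕ)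
    (p : MvPolynomial (ℕ × Fin 3) ℂ) :
    toStd y z 0 (p * MvPolynomial.X (i, 2)) = toStd y z 1 p * z i := by
  refine toStd_mul_X (fun s => ?_) p
  rw [toStd_monomial, toStd_monomial, indices_add_single_of_ne (by decide),
    indices_add_single_self, Multiset.card_add, Multiset.card_singleton]
  by_cases hs : (indices 1 s).card = (indices 2 s).card + 1
  · rw [if_pos (by omega), if_pos (by omega), (stdMonomial_mul_z hz i s).2 hs]
  · rw [if_neg (by omega), if_neg (by omega), zero_mul]

end Alternating

/-! ### Generic matrices -/

theorem eq_one_or_eq_gen (g : Z2) : g = 1 ∨ g = gen := by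
  revert g; decide

theorem gen_ne_one : gen ≠ 1 := by decide

theorem conjB_apply (a b c d : ℂ) : conjB !![a, b; c, d] = !![a, -b; -c, d] := by
  change B * !![a, b; c, d] * B⁻¹ = _
  rw [Matrix.inv_eq_right_inv B_mul_B]
  simp [B]

/-- Evaluation at the generic traceless matrices `x_i = [h_i, b_i; c_i, -h_i]`, where `h_i`, `b_i`,
`c_i` are the variables `(i, 0)`, `(i, 1)`, `(i, 2)`; accordingly
`x_i^g = [h_i, -b_i; -c_i, -h_i]`. -/
def genericEval : GPoly ℂ Z2 →ₐ[ℂ] Matrix (Fin 2) (Fin 2) (MvPolynomial (ℕ × Fin 3) ℂ) :=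
  FreeAlgebra.lift ℂ fun p : ℕ × Z2 =>
    if p.2 = 1 then
      !![MvPolynomial.X (p.1, 0), MvPolynomial.X (p.1, 1);
        MvPolynomial.X (p.1, 2), -MvPolynomial.X (p.1, 0)]
    else
      !![MvPolynomial.X (p.1, 0), -MvPolynomial.X (p.1, 1);
        -MvPolynomial.X (p.1, 2), -MvPolynomial.X (p.1, 0)]

/-- Specializing the generic matrices gives every evaluation in `sl₂(ℂ)`, and a polynomial over
the infinite field `ℂ` that vanishes at all points is zero. -/
theorem genericEval_eq_zero {f : GPoly ℂ Z2} (hf : f ∈ weakIdentities pairM2) :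
    genericEval f = 0 := by
  rw [mem_weakIdentities] at hf
  ext1 r s
  refine MvPolynomial.funext fun t => ?_
  let a : ℕ → Matrix (Fin 2) (Fin 2) ℂ := fun i => !![t (i, 0), t (i, 1); t (i, 2), -t (i, 0)]
  have ha : ∀ i, a i ∈ pairM2.lie := fun i => by
    change (a i).trace = 0
    simp [a, Matrix.trace_fin_two]
  have h : (MvPolynomial.aeval t).mapMatrix.comp genericEval = eval pairM2 a := by
    apply FreeAlgebra.hom_ext
    funext ⟨i, g⟩
    simp only [Function.comp_apply, AlgHom.comp_apply, eval_ι, genericEval, FreeAlgebra.lift_ι_apply]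
    rcases eq_one_or_eq_gen g with rfl | rfl
    · ext r s
      fin_cases r <;> fin_cases s <;> simp [a]
    · have : pairM2.act gen (a i) = conjB (a i) := by
        change actM2 gen (a i) = _
        rw [actM2_gen]
      rw [this, conjB_apply, if_neg gen_ne_one]
      ext r s
      fin_cases r <;> fin_cases s <;> simp
  have h0 : (MvPolynomial.aeval t).mapMatrix (genericEval f) = 0 := by
    rw [← hf a ha, ← h]
    rfl
  simpa [MvPolynomial.aeval_eq_eval] using congrFun (congrFun h0 r) s

/-! ### Reconstruction from generic values -/

section Reduction

variable {Q : Type*} [Ring Q] [Algebra ℂ Q] {π : GPoly ℂ Z2 →ₐ[ℂ] Q} {y z : ℕ → Q}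

/-- If the images `y_i + z_i` and `y_i - z_i` of `x_i` and `x_i^g` satisfy the three relations,
then the image of `f` can be recovered from the first row of the generic value of `f`. The reason is that
right multiplication by a generator has the same effect on both sides. -/
theorem map_eq_toStd (hπ₁ : ∀ i, π (FreeAlgebra.ι ℂ (i, 1)) = y i + z i)
    (hπg : ∀ i, π (FreeAlgebra.ι ℂ (i, gen)) = y i - z i)
    (hy : ∀ i j, y i * y j = y j * y i)
    (hyz : ∀ i j, z j * y i = -(y i * z j))
    (hz : ∀ i j k, z i * z j * z k = z k * z j * z i) (f : GPoly ℂ Z2) :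
    π f = toStd y z 0 (genericEval f 0 0) + toStd y z 1 (genericEval f 0 1) := by
  let N : GPoly ℂ Z2 → Q := fun f =>
    toStd y z 0 (genericEval f 0 0) + toStd y z 1 (genericEval f 0 1)
  have hadd : ∀ f v, N (f + v) = N f + N v := fun f v => by
    simp only [N, map_add, Matrix.add_apply]
    abel
  have key : ∀ v f, N (f * v) = N f * π v := by
    intro v
    induction v using FreeAlgebra.induction with
    | grade0 r =>
      intro f
      rw [← Algebra.commutes, ← Algebra.smul_def, AlgHom.commutes, ← Algebra.commutes,
        ← Algebra.smul_def]
      simp [N, smul_add]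
    | grade1 p =>
      obtain ⟨i, g⟩ := p
      intro f
      have h₀ := toStd_zero_mul_h hy hyz i (genericEval f 0 0)
      have h₁ := toStd_one_mul_h hy hyz i (genericEval f 0 1)
      have hb := toStd_mul_b (y := y) hz i (genericEval f 0 0)
      have hc := toStd_mul_c (y := y) hz i (genericEval f 0 1)
      rcases eq_one_or_eq_gen g with rfl | rfl
      · rw [hπ₁]
        simp [N, genericEval, Matrix.mul_apply, Fin.sum_univ_two] at h₀ h₁ hb hc ⊢
        rw [h₀, h₁, hb, hc]
        noncomm_ring
      · rw [hπg]
        simp [N, genericEval, Matrix.mul_apply, Fin.sum_univ_two, gen_ne_one] at h₀ h₁ hb hc ⊢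
        rw [h₀, h₁, hb, hc]
        noncomm_ring
    | mul u v hu hv => intro f; rw [← mul_assoc, hv, hu, map_mul, mul_assoc]
    | add u v hu hv => intro f; rw [mul_add, hadd, hu, hv, map_add, mul_add]
  have h1 : N 1 = 1 := by
    have := toStd_monomial (y := y) (z := z) 0 0
    rw [MvPolynomial.monomial_zero', map_one] at this
    simp [N, this, indices_zero, stdMonomial_zero]
  have := key f 1
  rw [one_mul, h1, one_mul] at this
  exact this.symm

end Reduction

/-! ### The three identities -/

theorem rename_pi0 (σ : ℕ → ℕ) (i : ℕ) : rename ℂ Z2 σ (pi0 (x i)) = pi0 (x (σ i)) := by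
  simp [pi0, var, freePair_act_ι, rename_ι]

theorem rename_pi1 (σ : ℕ → ℕ) (i : ℕ) : rename ℂ Z2 σ (pi1 (x i)) = pi1 (x (σ i)) := by
  simp [pi1, var, freePair_act_ι, rename_ι]

theorem eval_pi0 {a : ℕ → Matrix (Fin 2) (Fin 2) ℂ} (ha : ∀ i, a i ∈ pairM2.lie) (i : ℕ) :
    eval pairM2 a (pi0 (x i)) = !![2 * a i 0 0, 0; 0, -(2 * a i 0 0)] := by
  have h : (a i).trace = 0 := ha i
  rw [Matrix.trace_fin_two] at h
  have h' : eval pairM2 a (x i) = a i := by simp [var, eval_ι]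
  rw [pi0, map_add, eval_act, h']
  change a i + actM2 gen (a i) = _
  rw [actM2_gen, Matrix.eta_fin_two (a i), conjB_apply, eq_neg_of_add_eq_zero_right h]
  ext r s
  fin_cases r <;> fin_cases s <;> simp <;> ring

theorem eval_pi1 (a : ℕ → Matrix (Fin 2) (Fin 2) ℂ) (i : ℕ) :
    eval pairM2 a (pi1 (x i)) = !![0, 2 * a i 0 1; 2 * a i 1 0, 0] := by
  have h' : eval pairM2 a (x i) = a i := by simp [var, eval_ι]
  rw [pi1, map_sub, eval_act, h']
  change a i - actM2 gen (a i) = _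
  rw [actM2_gen, Matrix.eta_fin_two (a i), conjB_apply]
  ext r s
  fin_cases r <;> fin_cases s <;> simp <;> ring

/-- In a quotient by a `G`-ideal that contains the three polynomials, their relations hold for all
variables, so every weak identity reduces to zero. -/
theorem mem_of_mem_weakIdentities {I : TwoSidedIdeal (GPoly ℂ Z2)} (hI : IsGIdeal I)
    (h₁ : pi0 (x 1) * pi0 (x 2) - pi0 (x 2) * pi0 (x 1) ∈ I)
    (h₂ : pi1 (x 1) * pi1 (x 2) * pi1 (x 3) - pi1 (x 3) * pi1 (x 2) * pi1 (x 1) ∈ I)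
    (h₃ : pi0 (x 1) * pi1 (x 2) + pi1 (x 2) * pi0 (x 1) ∈ I)
    {f : GPoly ℂ Z2} (hf : f ∈ weakIdentities pairM2) : f ∈ I := by
  let π : GPoly ℂ Z2 →ₐ[ℂ] I.ringCon.Quotient := I.ringCon.mkₐ ℂ
  have hπ : ∀ f, π f = 0 ↔ f ∈ I := fun f => by
    rw [TwoSidedIdeal.mem_iff, ← map_zero π]
    exact RingCon.eq _
  -- The renaming that takes the variables `x₁, x₂, x₃` to `x_i, x_j, x_k`.
  let σ (i j k n : ℕ) : ℕ := if n = 1 then i else if n = 2 then j else k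
  have hσ (i j k : ℕ) {f} (h : f ∈ I) : π (rename ℂ Z2 (σ i j k) f) = 0 :=
    (hπ _).2 (hI _ (isGPairHom_rename _) _ h)
  let y : ℕ → I.ringCon.Quotient := fun i => (2⁻¹ : ℂ) • π (pi0 (x i))
  let z : ℕ → I.ringCon.Quotient := fun i => (2⁻¹ : ℂ) • π (pi1 (x i))
  have hy : ∀ i j, y i * y j = y j * y i := fun i j => by
    have := hσ i j 0 h₁
    simp only [map_sub, map_mul, rename_pi0, σ] at this
    simp only [y, smul_mul_smul_comm]
    exact congrArg _ (sub_eq_zero.1 this)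
  have hyz : ∀ i j, z j * y i = -(y i * z j) := fun i j => by
    have := hσ i j 0 h₃
    simp only [map_add, map_mul, rename_pi0, rename_pi1, σ] at this
    simp only [y, z, smul_mul_smul_comm]
    rw [← smul_neg]
    exact congrArg _ (eq_neg_of_add_eq_zero_right this)
  have hz : ∀ i j k, z i * z j * z k = z k * z j * z i := fun i j k => by
    have := hσ i j k h₂
    simp only [map_sub, map_mul, rename_pi1, σ] at this
    simp only [z, smul_mul_smul_comm]
    exact congrArg _ (sub_eq_zero.1 this)
  have e : ∀ i, FreeAlgebra.ι ℂ (i, gen) = (freePair ℂ Z2).act gen (x i) := fun i => by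
    simp [var, freePair_act_ι]
  have hπ₁ : ∀ i, π (FreeAlgebra.ι ℂ (i, 1)) = y i + z i := fun i => by
    simp only [y, z, ← map_smul, ← map_add, pi0, pi1]
    congr 1
    change x i = _
    module
  have hπg : ∀ i, π (FreeAlgebra.ι ℂ (i, gen)) = y i - z i := fun i => by
    rw [e]
    simp only [y, z, ← map_smul, ← map_sub, pi0, pi1]
    congr 1
    module
  rw [← hπ, map_eq_toStd hπ₁ hπg hy hyz hz, genericEval_eq_zero hf]
  simp

end

end WeakGId

theorem mainTheorem1 :
    WeakGId.IsBasis WeakGId.pairM2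
      {⁅WeakGId.pi0 (WeakGId.x 1), WeakGId.pi0 (WeakGId.x 2)⁆,
        WeakGId.pi1 (WeakGId.x 1) * WeakGId.pi1 (WeakGId.x 2) * WeakGId.pi1 (WeakGId.x 3)
          - WeakGId.pi1 (WeakGId.x 3) * WeakGId.pi1 (WeakGId.x 2) * WeakGId.pi1 (WeakGId.x 1),
        WeakGId.pi0 (WeakGId.x 1) * WeakGId.pi1 (WeakGId.x 2)
          + WeakGId.pi1 (WeakGId.x 2) * WeakGId.pi0 (WeakGId.x 1)} := by
  refine ⟨⟨WeakGId.isGIdeal_weakIdentities _, ?_⟩, fun I hI f hf => ?_⟩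
  · rintro f (rfl | rfl | rfl) <;> rw [WeakGId.mem_weakIdentities] <;> intro a ha
    · rw [Ring.lie_def]
      simp [WeakGId.eval_pi0 ha, mul_comm]
    · ext r s
      fin_cases r <;> fin_cases s <;> simp [WeakGId.eval_pi1] <;> ring
    · ext r s
      fin_cases r <;> fin_cases s <;> simp [WeakGId.eval_pi0 ha, WeakGId.eval_pi1] <;> ring
  · refine WeakGId.mem_of_mem_weakIdentities hI.1 ?_ (hI.2 _ (by simp)) (hI.2 _ (by simp)) hf
    rw [← Ring.lie_def]
    exact hI.2 _ (by simp)
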